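/- Conventions. Inner products $\langle x,y\rangle$ are linear in $x$; $\otimes$ and $\oplus$ are Hilbert space tensor product and direct sum. Let $K$ be a Pick kernel on a set $\Lambda$, i.e. a nowhere vanishing positive definite kernel such that for every $\lambda_0\in\Lambda$ the kernel $1-\frac{K(\mu,\lambda_0)K(\lambda_0,\lambda)}{K(\mu,\lambda)K(\lambda_0,\lambda_0)}$ is positive definite. Let $\mathfrak H(K)$ be the reproducing kernel Hilbert space of $K$, with kernel functions $k_\lambda=K(\cdot,\lambda)$. Fix $\lambda_0\in\Lambda$, put $\delta=k_{\lambda_0}/\|k_{\lambda_0}\|$, and let $\mathcal B$ be a Hilbert space and $\beta:\Lambda\to\mathcal B$ a map whose range has dense linear span, with $$K(\mu,\lambda)=\frac{\delta(\mu)\overline{\delta(\lambda)}}{1-\langle\beta(\lambda),\beta(\mu)\rangle}\qquad(\mu,\lambda\in\Lambda).$$ Let $B(\lambda):\mathcal B\to\mathbb C$, $B(\lambda)x=\langle x,\beta(\lambda)\rangle$. A function $G:\Lambda\to\mathcal L(\mathcal G',\mathbb C)$ ($\mathcal G'$ a Hilbert space) is a contractive multiplier if $k_\lambda\mapsto G(\lambda)^*1\otimes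 k_\lambda$ extends to a linear contraction $\mathfrak m_G^*:\mathfrak H(K)\to\mathcal G'\otimes\mathfrak H(K)$; then $\mathcal M_G$ is the range of $\mathfrak m_G$ with the range norm $\|f\|=\inf\{\|g\|:\mathfrak m_Gg=f\}$. The complementary subspace $\mathcal M_G^\sharp$ is the unique Hilbert space contractively included in $\mathfrak H(K)$ such that $\|x'+x''\|^2_{\mathfrak H(K)}\le\|x'\|_{\mathcal M_G}^2+\|x''\|_{\mathcal M_G^\sharp}^2$ for all $x'\in\mathcal M_G$, $x''\in\mathcal M_G^\sharp$, and every $x\in\mathfrak H(K)$ has a unique decomposition $x=x'+x''$ of this kind for which equality holds. The function $B$ is a contractive multiplier; write $\bm B=\mathfrak m_B$, so $\bm B^*k_\lambda=\beta(\lambda)\otimes k_\lambda$. Let $J$ be a conjugation (antilinear isometric involution) of $\mathcal B$ and $\bar\beta=J\beta$. Let $\mathcal D(\mathbb B)$ be the Drury--Arveson space: the reproducing kernel Hilbert space on the open unit ball $\mathbb B$ of $\mathcal B$ with kernel $1/(1-\langle\eta,\xi\rangle)$. A set $E\subset\mathbb B$ is a uniqueness set for $\mathcal D(\mathbb B)$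 if $f\in\mathcal D(\mathbb B)$ and $f|_E\equiv0$ imply $f\equiv0$. Theorem. Suppose that $K$ is normalized at $\lambda_0$ (i.e. $\delta\equiv1$) and that the image of $\bar\beta$ is not a uniqueness set for $\mathcal D(\mathbb B)$. Then there is a unitary $$U=\begin{pmatrix}\bm a&\bm b\\ \bm c&\bm d\end{pmatrix}:\mathbb C\oplus\mathcal B\to\mathcal B\oplus\mathbb C$$ with the following properties. For every $\lambda\in\Lambda$ the operator $1-B(\lambda)\bm a$ is invertible, and $G(\lambda)=\bm d+\bm c(1-B(\lambda)\bm a)^{-1}B(\lambda)\bm b$ defines a contractive multiplier $G:\Lambda\to\mathcal L(\mathcal B,\mathbb C)$. The coordinates $\bm a_\eta=L_\eta^*\bm a:\mathbb C\to\mathbb C$, where $L_\eta:\mathbb C\to\mathcal B$, $L_\eta t=t\eta$, satisfy $\bm a_\eta\bm a_{\eta'}=\bm a_{\eta'}\bm a_\eta$ for all $\eta,\eta'\in\mathcal B$. Nevertheless $\bm B^*(\mathcal M_G^\sharp)\not\subset\mathcal B\otimes\mathcal M_G^\sharp$. -/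

import Mathlib

open scoped TensorProduct ComplexConjugate ComplexOrder InnerProductSpace

noncomputable section

namespace PickSpace

universe u v w

/-! ### Hilbert space tensor products -/

/-- The Hilbert space tensor product: the completion of the algebraic tensor product for the inner
product `⟪x ⊗ y, x' ⊗ y'⟫ = ⟪x, x'⟫ ⟪y, y'⟫`. -/
abbrev HilbertTensor (E : Type u) (F : Type v)
    [NormedAddCommGroup E] [InnerProductSpace ℂ E]
    [NormedAddCommGroup F] [InnerProductSpace ℂ F] : Type (max u v) :=
  UniformSpace.Completion (E ⊗[ℂ] F)

/-- The elementary tensor `x ⊗ y` in the Hilbert space tensor product. -/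
def htmul {E : Type u} {F : Type v}
    [NormedAddCommGroup E] [InnerProductSpace ℂ E]
    [NormedAddCommGroup F] [InnerProductSpace ℂ F] (x : E) (y : F) : HilbertTensor E F :=
  ((x ⊗ₜ[ℂ] y : E ⊗[ℂ] F) : UniformSpace.Completion (E ⊗[ℂ] F))

/-- The operator `I ⊗ g` on Hilbert space tensor products. -/
def idTensor (E : Type u) {F : Type v} {F' : Type w}
    [NormedAddCommGroup E] [InnerProductSpace ℂ E]
    [NormedAddCommGroup F] [InnerProductSpace ℂ F]
    [NormedAddCommGroup F'] [InnerProductSpace ℂ F'] (g : F →L[ℂ] F') :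
    HilbertTensor E F →L[ℂ] HilbertTensor E F' :=
  (g.lTensor E).completion

/-! ### Contractively included subspaces and complementary subspaces -/

/-- A Hilbert space contractively included in the Hilbert space `H`: a Hilbert space `space`
identified with a vector subspace of `H` by the injective linear map `incl`, with
`‖incl x‖ ≤ ‖x‖`. -/
structure ContractiveSubspace (H : Type u) [NormedAddCommGroup H] [InnerProductSpace ℂ H] where
  space : Type v
  [normed : NormedAddCommGroup space]
  [inner : InnerProductSpace ℂ space]
  [complete : CompleteSpace space]
  incl : space →L[ℂ] H
  incl_injective : Function.Injective incl
  norm_incl_le : ∀ x, ‖incl x‖ ≤ ‖x‖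

attribute [instance] ContractiveSubspace.normed ContractiveSubspace.inner
  ContractiveSubspace.complete

/-- The underlying vector subspace of `H`. -/
def ContractiveSubspace.carrier {H : Type u} [NormedAddCommGroup H] [InnerProductSpace ℂ H]
    (S : ContractiveSubspace.{u, v} H) : Submodule ℂ H :=
  LinearMap.range S.incl.toLinearMap

/-- The vector subspace `E ⊗ S` of `E ⊗ H`, for `S` contractively included in `H`: the Hilbert
space tensor product of `E` and `S`, viewed inside `E ⊗ H`. -/
def ContractiveSubspace.tensorCarrier {H : Type u} [NormedAddCommGroup H] [InnerProductSpace ℂ H]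
    (E : Type w) [NormedAddCommGroup E] [InnerProductSpace ℂ E]
    (S : ContractiveSubspace.{u, v} H) : Submodule ℂ (HilbertTensor E H) :=
  LinearMap.range (idTensor E S.incl).toLinearMap

/-- `T` is the complementary subspace of `S` in `H`. -/
structure ContractiveSubspace.IsComplementary {H : Type u} [NormedAddCommGroup H]
    [InnerProductSpace ℂ H] (S : ContractiveSubspace.{u, v} H)
    (T : ContractiveSubspace.{u, w} H) : Prop where
  norm_add_sq_le : ∀ (x : S.space) (y : T.space), ‖S.incl x + T.incl y‖ ^ 2 ≤ ‖x‖ ^ 2 + ‖y‖ ^ 2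
  existsUnique_decomposition : ∀ h : H, ∃! p : S.space × T.space,
    S.incl p.1 + T.incl p.2 = h ∧ ‖h‖ ^ 2 = ‖p.1‖ ^ 2 + ‖p.2‖ ^ 2

/-- The range of a contraction `C`, with the range norm `‖x‖ = inf {‖y‖ : C y = x}`, that is, with
the norm that makes `C` unitary from `(ker C)ᗮ` onto its range. -/
def rangeSpace {C : Type v} {H : Type u} [NormedAddCommGroup C] [InnerProductSpace ℂ C]
    [CompleteSpace C] [NormedAddCommGroup H] [InnerProductSpace ℂ H]
    (T : C →L[ℂ] H) (hT : ‖T‖ ≤ 1) : ContractiveSubspace.{u, v} H where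
  space := (LinearMap.ker T.toLinearMap)ᗮ
  incl := T ∘L (LinearMap.ker T.toLinearMap)ᗮ.subtypeL
  incl_injective := by
    rw [injective_iff_map_eq_zero]
    intro x hx
    have h1 : (x : C) ∈ LinearMap.ker T.toLinearMap := by simpa using hx
    have h2 := (Submodule.mem_orthogonal _ _).1 x.2 x h1
    exact Subtype.ext (inner_self_eq_zero.1 h2)
  norm_incl_le x := by
    simpa using T.le_of_opNorm_le hT (x : C)

/-! ### Kernels, multipliers, Pick kernels -/

section Kernels

variable {Λ : Type w} (H : Type u) [NormedAddCommGroup H] [InnerProductSpace ℂ H]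
  [CompleteSpace H] [RKHS ℂ H Λ ℂ]

/-- The function `k_l ∈ H`, for which `f l = ⟨f, k_l⟩`. -/
def ker (l : Λ) : H := RKHS.kerFun H l 1

/-- The reproducing kernel `K (m, l) = k_l m`. -/
def kernel (m l : Λ) : ℂ := ker H l m

/-- The normalization `δ = k_{l₀} / ‖k_{l₀}‖`. -/
def normalizedKer (l₀ : Λ) : H := ((‖ker H l₀‖ : ℂ))⁻¹ • ker H l₀

/-- `H` is normalized at `l₀`: the function `δ` is identically `1`. -/
def IsNormalizedAt (l₀ : Λ) : Prop := ∀ m, normalizedKer H l₀ m = 1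

variable {G' : Type v} [NormedAddCommGroup G'] [InnerProductSpace ℂ G'] [CompleteSpace G']

/-- `T : H → G' ⊗ H` is the adjoint of the operator of multiplication by
`G : Λ → L(G', ℂ)`: it maps `k_l` to `G(l)^* 1 ⊗ k_l`. -/
def IsMultiplierAdjoint (G : Λ → G' →L[ℂ] ℂ) (T : H →L[ℂ] HilbertTensor G' H) : Prop :=
  ∀ l, T (ker H l) = htmul ((G l).adjoint 1) (ker H l)

/-- `G : Λ → L(G', ℂ)` is a contractive multiplier from `G' ⊗ H` to `H`. -/
def IsContractiveMultiplier (G : Λ → G' →L[ℂ] ℂ) : Prop :=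
  ∃ T : H →L[ℂ] HilbertTensor G' H, ‖T‖ ≤ 1 ∧ IsMultiplierAdjoint H G T

variable {H}

/-- The adjoint `m_G^* : H → G' ⊗ H` of the multiplication operator; it is determined by `G`,
see `multiplierAdjoint_unique`. -/
def multiplierAdjoint {G : Λ → G' →L[ℂ] ℂ} (hG : IsContractiveMultiplier H G) :
    H →L[ℂ] HilbertTensor G' H := hG.choose

theorem norm_multiplierAdjoint_le {G : Λ → G' →L[ℂ] ℂ} (hG : IsContractiveMultiplier H G) :
    ‖multiplierAdjoint hG‖ ≤ 1 := hG.choose_spec.1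

theorem multiplierAdjoint_unique {G : Λ → G' →L[ℂ] ℂ} (hG : IsContractiveMultiplier H G)
    (T : H →L[ℂ] HilbertTensor G' H) (hT : IsMultiplierAdjoint H G T) :
    T = multiplierAdjoint hG := by
  refine ContinuousLinearMap.ext_on
    (Submodule.dense_iff_topologicalClosure_eq_top.2 (RKHS.kerFun_dense (𝕜 := ℂ) H)) ?_
  rintro _ ⟨x, v, rfl⟩
  have hv : RKHS.kerFun H x v = v • ker H x := by
    rw [ker, ← map_smul, smul_eq_mul, mul_one]
  rw [hv, map_smul, map_smul, hT x, multiplierAdjoint, hG.choose_spec.2 x]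

/-- The multiplication operator `m_G : G' ⊗ H → H`. -/
def multiplier {G : Λ → G' →L[ℂ] ℂ} (hG : IsContractiveMultiplier H G) :
    HilbertTensor G' H →L[ℂ] H := (multiplierAdjoint hG).adjoint

/-- `M_G`: the range of `m_G` with the range norm. -/
def multiplierRange {G : Λ → G' →L[ℂ] ℂ} (hG : IsContractiveMultiplier H G) :
    ContractiveSubspace.{u, max v u} H :=
  rangeSpace (multiplier hG) (by
    rw [multiplier, LinearIsometryEquiv.norm_map]
    exact norm_multiplierAdjoint_le hG)

end Kernels

/-- A Pick kernel: a (nowhere vanishing) positive definite kernel `K` such that, for every base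
point `l₀`, the kernel `1 - K(m, l₀) K(l₀, l) / (K(m, l) K(l₀, l₀))` is positive definite. -/
structure IsPickKernel {Λ : Type w} (K : Λ → Λ → ℂ) : Prop where
  posSemidef : (Matrix.of K).PosSemidef
  ne_zero : ∀ m l, K m l ≠ 0
  pick : ∀ l₀ : Λ,
    (Matrix.of fun m l => 1 - K m l₀ * K l₀ l / (K m l * K l₀ l₀)).PosSemidef

section Realization

variable {Λ : Type w} (H : Type u) [NormedAddCommGroup H] [InnerProductSpace ℂ H]
  [CompleteSpace H] [RKHS ℂ H Λ ℂ]
  {B : Type v} [NormedAddCommGroup B] [InnerProductSpace ℂ B]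

/-- `β : Λ → B` represents the Pick kernel of `H` with base point `l₀`:
`K(m, l) = δ(m) conj (δ(l)) / (1 - ⟨β(l), β(m)⟩)`, and `β` has dense linear span in `B`.
(The inner product `⟨x, y⟩`, linear in `x`, is Mathlib's `⟪y, x⟫_ℂ`.) -/
structure IsPickRealization (l₀ : Λ) (β : Λ → B) : Prop where
  kernel_eq : ∀ m l, kernel H m l =
    normalizedKer H l₀ m * conj (normalizedKer H l₀ l) / (1 - ⟪β m, β l⟫_ℂ)
  minimal : (Submodule.span ℂ (Set.range β)).topologicalClosure = ⊤

/-- The row `B(l) : B → ℂ`, `B(l) x = ⟨x, β(l)⟩`. -/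
def row (β : Λ → B) (l : Λ) : B →L[ℂ] ℂ := innerSL ℂ (β l)

end Realization

/-! ### The Drury-Arveson space -/

section DruryArveson

variable (B : Type v) [NormedAddCommGroup B] [InnerProductSpace ℂ B]

/-- The Drury-Arveson kernel `1 / (1 - ⟨z, w⟩)` on the open unit ball of `B`. -/
def druryArvesonKernel (z w : Metric.ball (0 : B) 1) : ℂ := 1 / (1 - ⟪(w : B), (z : B)⟫_ℂ)

theorem posSemidef_druryArvesonKernel : (Matrix.of (druryArvesonKernel B)).PosSemidef := by
  have herm : (Matrix.of (druryArvesonKernel B)).IsHermitian := by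
    ext z w
    simp [druryArvesonKernel]
  have hpow : ∀ n : ℕ, (Matrix.of fun z w : Metric.ball (0 : B) 1 =>
      ⟪(w : B), (z : B)⟫_ℂ ^ n).PosSemidef := by
    have hgram : (Matrix.of fun z w : Metric.ball (0 : B) 1 =>
        ⟪(w : B), (z : B)⟫_ℂ).PosSemidef := by
      refine ⟨by ext z w; simp, fun x => ?_⟩
      have h : (x.sum fun i xi => x.sum fun j xj => star xi *
          (Matrix.of fun z w : Metric.ball (0 : B) 1 => ⟪(w : B), (z : B)⟫_ℂ) i j * xj) =
          ⟪x.sum fun i xi => conj xi • (i : B), x.sum fun i xi => conj xi • (i : B)⟫_ℂ := by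
        simp only [Finsupp.sum, sum_inner, inner_sum, inner_smul_left, inner_smul_right,
          Matrix.of_apply, RCLike.star_def, starRingEnd_self_apply]
        refine Finset.sum_congr rfl fun i _ => ?_
        rw [Finset.mul_sum]
        refine Finset.sum_congr rfl fun j _ => ?_
        ring
      rw [h, inner_self_eq_norm_sq_to_K]
      simp
    intro n
    induction n with
    | zero =>
      refine ⟨by ext z w; simp, fun x => ?_⟩
      have h : (x.sum fun i xi => x.sum fun j xj => star xi *
          (Matrix.of fun z w : Metric.ball (0 : B) 1 => ⟪(w : B), (z : B)⟫_ℂ ^ 0) i j * xj) =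
          star (x.sum fun _ xi => xi) * (x.sum fun _ xi => xi) := by
        simp only [Finsupp.sum, Matrix.of_apply, pow_zero, mul_one, star_sum, Finset.sum_mul_sum]
      rw [h]
      exact star_mul_self_nonneg _
    | succ n ih =>
      have h := ih.hadamard hgram
      have h' : (Matrix.of fun z w : Metric.ball (0 : B) 1 => ⟪(w : B), (z : B)⟫_ℂ ^ (n + 1)) =
          Matrix.hadamard (Matrix.of fun z w : Metric.ball (0 : B) 1 => ⟪(w : B), (z : B)⟫_ℂ ^ n)
            (Matrix.of fun z w : Metric.ball (0 : B) 1 => ⟪(w : B), (z : B)⟫_ℂ) := by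
        ext z w
        simp [Matrix.hadamard, pow_succ]
      rw [h']
      exact h
  have hgeom : ∀ z w : Metric.ball (0 : B) 1,
      HasSum (fun n : ℕ => ⟪(w : B), (z : B)⟫_ℂ ^ n) (druryArvesonKernel B z w) := by
    intro z w
    have hz : ‖(z : B)‖ < 1 := mem_ball_zero_iff.1 z.2
    have hw : ‖(w : B)‖ < 1 := mem_ball_zero_iff.1 w.2
    have h : ‖⟪(w : B), (z : B)⟫_ℂ‖ < 1 := by
      refine (norm_inner_le_norm _ _).trans_lt ?_
      nlinarith [norm_nonneg (z : B), norm_nonneg (w : B)]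
    simpa [druryArvesonKernel] using hasSum_geometric_of_norm_lt_one h
  refine ⟨herm, fun x => ?_⟩
  have hsum : HasSum (fun n : ℕ => x.sum fun i xi => x.sum fun j xj => star xi *
      (Matrix.of fun z w : Metric.ball (0 : B) 1 => ⟪(w : B), (z : B)⟫_ℂ ^ n) i j * xj)
      (x.sum fun i xi => x.sum fun j xj => star xi *
        (Matrix.of (druryArvesonKernel B)) i j * xj) :=
    hasSum_sum fun i _ => hasSum_sum fun j _ => ((hgeom i j).mul_left _).mul_right _
  exact hsum.nonneg fun n => (hpow n).2 x

/-- The Drury-Arveson kernel, as a kernel with values in `L(ℂ)`. -/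
def druryArvesonMatrix :
    Matrix (Metric.ball (0 : B) 1) (Metric.ball (0 : B) 1) (ℂ →L[ℂ] ℂ) :=
  Matrix.of fun z w => druryArvesonKernel B z w • ContinuousLinearMap.id ℂ ℂ

instance : Fact (druryArvesonMatrix B).PosSemidef := ⟨by
  have hP := posSemidef_druryArvesonKernel B
  have hH : (druryArvesonMatrix B).IsHermitian := by
    ext z w
    simp [druryArvesonMatrix, druryArvesonKernel, ContinuousLinearMap.star_eq_adjoint,
      ContinuousLinearMap.adjoint_id]
  refine ((RKHS.posSemidef_tfae (K := druryArvesonMatrix B)).out 0 2 rfl rfl).2 ?_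
  refine ⟨hH, fun f => ?_⟩
  have h := (RCLike.nonneg_iff.1 (hP.2 f)).1
  simp only [Finsupp.sum] at h ⊢
  refine h.trans_eq (congrArg _ (Finset.sum_congr rfl fun i _ => ?_))
  refine Finset.sum_congr rfl fun j _ => ?_
  have hK : conj (druryArvesonKernel B j i) = druryArvesonKernel B i j := by
    simp [druryArvesonKernel]
  simp only [druryArvesonMatrix, Matrix.of_apply, smul_apply,
    ContinuousLinearMap.id_apply, smul_eq_mul, RCLike.inner_apply, map_mul, hK, RCLike.star_def]
  ring⟩

/-- The Drury-Arveson space: the reproducing kernel Hilbert space on the open unit ball of `B`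
with the Drury-Arveson kernel. -/
abbrev DruryArveson : Type v := RKHS.OfKernel (druryArvesonMatrix B)

theorem kernel_druryArveson (z w : Metric.ball (0 : B) 1) :
    kernel (DruryArveson B) z w = druryArvesonKernel B z w := by
  rw [kernel, ker, RKHS.kerFun_apply, RKHS.OfKernel.kernel_ofKernel]
  simp [druryArvesonMatrix]

variable {B}

/-- `E` is a uniqueness set for the Drury-Arveson space. -/
def IsUniquenessSet (E : Set (Metric.ball (0 : B) 1)) : Prop :=
  ∀ f : DruryArveson B, (∀ z ∈ E, f z = 0) → f = 0

end DruryArveson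

/-! ### Colligations -/

section Colligation

variable {X : Type*} {G' : Type*} {Y : Type*} {G : Type*}
  [NormedAddCommGroup X] [InnerProductSpace ℂ X] [NormedAddCommGroup G'] [InnerProductSpace ℂ G']
  [NormedAddCommGroup Y] [InnerProductSpace ℂ Y] [NormedAddCommGroup G] [InnerProductSpace ℂ G]

/-- The Hilbert space direct sum `X ⊕ Y`. -/
abbrev DirectSum2 (X Y : Type*) := WithLp 2 (X × Y)

/-- The embedding of the first summand into `X ⊕ Y`. -/
def inclLeft (X Y : Type*) [NormedAddCommGroup X] [InnerProductSpace ℂ X]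
    [NormedAddCommGroup Y] [InnerProductSpace ℂ Y] : X →L[ℂ] DirectSum2 X Y :=
  (WithLp.prodContinuousLinearEquiv 2 ℂ X Y).symm.toContinuousLinearMap ∘L
    ContinuousLinearMap.inl ℂ X Y

/-- The embedding of the second summand into `X ⊕ Y`. -/
def inclRight (X Y : Type*) [NormedAddCommGroup X] [InnerProductSpace ℂ X]
    [NormedAddCommGroup Y] [InnerProductSpace ℂ Y] : Y →L[ℂ] DirectSum2 X Y :=
  (WithLp.prodContinuousLinearEquiv 2 ℂ X Y).symm.toContinuousLinearMap ∘L
    ContinuousLinearMap.inr ℂ X Y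

/-- The entry `a : X → Y` of the matrix of `U : X ⊕ G' → Y ⊕ G`. -/
def blockA (U : DirectSum2 X G' ≃ₗᵢ[ℂ] DirectSum2 Y G) : X →L[ℂ] Y :=
  WithLp.fstL 2 ℂ Y G ∘L (U : DirectSum2 X G' →L[ℂ] DirectSum2 Y G) ∘L inclLeft X G'

/-- The entry `b : G' → Y`. -/
def blockB (U : DirectSum2 X G' ≃ₗᵢ[ℂ] DirectSum2 Y G) : G' →L[ℂ] Y :=
  WithLp.fstL 2 ℂ Y G ∘L (U : DirectSum2 X G' →L[ℂ] DirectSum2 Y G) ∘L inclRight X G'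

/-- The entry `c : X → G`. -/
def blockC (U : DirectSum2 X G' ≃ₗᵢ[ℂ] DirectSum2 Y G) : X →L[ℂ] G :=
  WithLp.sndL 2 ℂ Y G ∘L (U : DirectSum2 X G' →L[ℂ] DirectSum2 Y G) ∘L inclLeft X G'

/-- The entry `d : G' → G`. -/
def blockD (U : DirectSum2 X G' ≃ₗᵢ[ℂ] DirectSum2 Y G) : G' →L[ℂ] G :=
  WithLp.sndL 2 ℂ Y G ∘L (U : DirectSum2 X G' →L[ℂ] DirectSum2 Y G) ∘L inclRight X G'

/-- The value `d + c (I - Z a)⁻¹ Z b` of the transfer function of the colligation `U` at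
`Z : Y → X`. -/
def transferFunction (U : DirectSum2 X G' ≃ₗᵢ[ℂ] DirectSum2 Y G) (Z : Y →L[ℂ] X) : G' →L[ℂ] G :=
  blockD U + blockC U ∘L Ring.inverse (1 - Z ∘L blockA U : X →L[ℂ] X) ∘L Z ∘L blockB U

/-- The coordinate `a_x = L_x^* a : ℂ → ℂ` of `a : ℂ → B = B ⊗ ℂ`, where `L_x : ℂ → B ⊗ ℂ = B` is
the operator `L_x t = x ⊗ t = t x`. -/
def coordinate {B : Type*} [NormedAddCommGroup B] [InnerProductSpace ℂ B] [CompleteSpace B]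
    (a : ℂ →L[ℂ] B) (x : B) : ℂ →L[ℂ] ℂ :=
  (ContinuousLinearMap.toSpanSingleton ℂ x).adjoint ∘L a

end Colligation

end PickSpace

end

/-! Some `f` in the Drury-Arveson space vanishes on the image of `J β` but not at some point α' of
the ball. Put α = J α' and let `U` be the Halmos unitary whose first column is the unit vector (α,
s), where s² = 1 - ‖α‖². The state space is ℂ, so the coordinates of the entry a commute trivially,
and the resolvent is division by 1 - ⟪β l, α⟫.

Since K(m, l) = 1 / (1 - ⟪β m, β l⟫), the kernel (1 - G(m) G(l)^*) K(m, l) collapses to g(m)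
conj(g(l)) with g(l) = s / (1 - ⟪β l, α⟫) (`inner_transferFunction_halmos`). Thus 1 - m_G m_G^* has
rank one and the complementary space is the line through g (`isComplementary_multiplierRange_iff`).
Invariance of that line would make g a joint eigenvector, B^* g = x ⊗ g.

Sending k_l to the Drury-Arveson kernel function at J (β l) gives an isometry W that intertwines B^*
with its Drury-Arveson analogue. The joint eigenvectors there are multiples of kernel functions, so
W g is s times the kernel function at α'. But `f` is orthogonal to the range of W, hence f(α') = 0,
a contradiction (`apply_eq_zero_of_eigenvector`). -/

noncomputable section

namespace PickSpace

universe u v w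

/-! ### Hilbert space tensor products and isometries from Gram matrices -/

section HilbertSpace

variable {E : Type u} {F : Type v} {F' : Type w}
  [NormedAddCommGroup E] [InnerProductSpace ℂ E]
  [NormedAddCommGroup F] [InnerProductSpace ℂ F]
  [NormedAddCommGroup F'] [InnerProductSpace ℂ F']

theorem inner_htmul (x x' : E) (y y' : F) :
    ⟪htmul x y, htmul x' y'⟫_ℂ = ⟪x, x'⟫_ℂ * ⟪y, y'⟫_ℂ := by
  simp [htmul, UniformSpace.Completion.inner_coe]

theorem idTensor_htmul (g : F →L[ℂ] F') (x : E) (y : F) :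
    idTensor E g (htmul x y) = htmul x (g y) := by
  simp [idTensor, htmul]

/-- Continuous linear maps on a Hilbert space tensor product are determined by their values on
elementary tensors. -/
theorem clm_ext_htmul {f g : HilbertTensor E F →L[ℂ] F'}
    (h : ∀ x y, f (htmul x y) = g (htmul x y)) : f = g := by
  ext t
  induction t using UniformSpace.Completion.induction_on with
  | hp => exact isClosed_eq f.continuous g.continuous
  | ih t =>
    induction t using TensorProduct.induction_on with
    | zero => simp only [UniformSpace.Completion.coe_zero, map_zero]
    | tmul x y => exact h x y
    | add s t hs ht => simp only [UniformSpace.Completion.coe_add, map_add, hs, ht]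

theorem htmul_smul_right (c : ℂ) (x : E) (y : F) : htmul x (c • y) = c • htmul x y := by
  simp only [htmul, TensorProduct.tmul_smul, UniformSpace.Completion.coe_smul]

theorem htmul_sub_right (x : E) (y y' : F) : htmul x (y - y') = htmul x y - htmul x y' := by
  simp only [htmul, TensorProduct.tmul_sub, UniformSpace.Completion.coe_sub]

/-- The operator `x ↦ x ⊗ y`. -/
def htmulRight (E : Type u) [NormedAddCommGroup E] [InnerProductSpace ℂ E] (y : F) :
    E →L[ℂ] HilbertTensor E F :=
  LinearMap.mkContinuous
    { toFun := fun x => htmul x y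
      map_add' := fun x x' => by
        simp only [htmul, TensorProduct.add_tmul, UniformSpace.Completion.coe_add]
      map_smul' := fun c x => by
        simp only [htmul, ← TensorProduct.smul_tmul', UniformSpace.Completion.coe_smul,
          RingHom.id_apply] }
    ‖y‖ fun x => by simp [htmul, mul_comm]

theorem htmulRight_apply (x : E) (y : F) : htmulRight E y x = htmul x y := rfl

theorem inner_htmul_idTensor [CompleteSpace F] [CompleteSpace F'] (g : F →L[ℂ] F') (x : E)
    (y : F') (t : HilbertTensor E F) :
    ⟪htmul x y, idTensor E g t⟫_ℂ = ⟪htmul x (g.adjoint y), t⟫_ℂ := by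
  have : innerSL ℂ (htmul x y) ∘L idTensor E g = innerSL ℂ (htmul x (g.adjoint y)) := by
    refine clm_ext_htmul fun x' y' => ?_
    simp [idTensor_htmul, inner_htmul, ContinuousLinearMap.adjoint_inner_left]
  exact DFunLike.congr_fun this t

/-- Two families of vectors with the same Gram matrix are related by an isometry. -/
theorem exists_isometry_of_inner_eq [CompleteSpace F] {ι : Type*} {u : ι → E} {e : ι → F}
    (hu : (Submodule.span ℂ (Set.range u)).topologicalClosure = ⊤)
    (h : ∀ i j, ⟪e i, e j⟫_ℂ = ⟪u i, u j⟫_ℂ) :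
    ∃ V : E →ₗᵢ[ℂ] F, ∀ i, V (u i) = e i := by
  have hnorm : ∀ c : ι →₀ ℂ,
      ‖Finsupp.linearCombination ℂ e c‖ = ‖Finsupp.linearCombination ℂ u c‖ := by
    intro c
    have : ⟪Finsupp.linearCombination ℂ e c, Finsupp.linearCombination ℂ e c⟫_ℂ =
        ⟪Finsupp.linearCombination ℂ u c, Finsupp.linearCombination ℂ u c⟫_ℂ := by
      simp only [Finsupp.linearCombination_apply, Finsupp.sum, sum_inner, inner_sum,
        inner_smul_left, inner_smul_right, h]
    rw [@norm_eq_sqrt_re_inner ℂ, @norm_eq_sqrt_re_inner ℂ, this]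
  have hdense : DenseRange (Finsupp.linearCombination ℂ u) := by
    have := Submodule.dense_iff_topologicalClosure_eq_top.2 hu
    rwa [← Finsupp.range_linearCombination] at this
  let V := (Finsupp.linearCombination ℂ e).extendOfNorm (Finsupp.linearCombination ℂ u)
  have hV : ∀ c, V (Finsupp.linearCombination ℂ u c) = Finsupp.linearCombination ℂ e c := fun c =>
    LinearMap.extendOfNorm_eq hdense ⟨1, fun c => by rw [hnorm, one_mul]⟩ c
  refine ⟨⟨V.toLinearMap, fun x => ?_⟩, fun i => ?_⟩
  · refine hdense.induction_on x (isClosed_eq V.continuous.norm continuous_norm) fun c => ?_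
    exact (congrArg _ (hV c)).trans (hnorm c)
  · simpa using hV (Finsupp.single i 1)

end HilbertSpace

/-! ### Complementary subspaces as an operator identity; the rank one case -/

section Complementary

variable {H : Type u} [NormedAddCommGroup H] [InnerProductSpace ℂ H] [CompleteSpace H]

namespace ContractiveSubspace

variable {S : ContractiveSubspace.{u, v} H} {T : ContractiveSubspace.{u, w} H}

/-- Expand ‖x - S^* h‖² + ‖y - T^* h‖²: the real parts of the inner products add up to ‖h‖², so the
sum is at most ‖h‖² - 2‖h‖² + ‖h‖² = 0. This is the uniqueness of the optimal decomposition. -/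
theorem eq_adjoint_of_norm_sq_eq {x : S.space} {y : T.space} {h : H}
    (hle : ‖S.incl.adjoint h‖ ^ 2 + ‖T.incl.adjoint h‖ ^ 2 ≤ ‖h‖ ^ 2)
    (hxy : S.incl x + T.incl y = h) (hn : ‖h‖ ^ 2 = ‖x‖ ^ 2 + ‖y‖ ^ 2) :
    x = S.incl.adjoint h ∧ y = T.incl.adjoint h := by
  have h1 := @norm_sub_sq ℂ _ _ _ _ x (S.incl.adjoint h)
  have h2 := @norm_sub_sq ℂ _ _ _ _ y (T.incl.adjoint h)
  have h3 : RCLike.re ⟪x, S.incl.adjoint h⟫_ℂ + RCLike.re ⟪y, T.incl.adjoint h⟫_ℂ = ‖h‖ ^ 2 := by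
    rw [ContinuousLinearMap.adjoint_inner_right, ContinuousLinearMap.adjoint_inner_right,
      ← map_add, ← inner_add_left, hxy, inner_self_eq_norm_sq]
  have h4 := sq_nonneg ‖x - S.incl.adjoint h‖
  have h5 := sq_nonneg ‖y - T.incl.adjoint h‖
  refine ⟨sub_eq_zero.1 (norm_eq_zero.1 (sq_eq_zero_iff.1 ?_)),
    sub_eq_zero.1 (norm_eq_zero.1 (sq_eq_zero_iff.1 ?_))⟩ <;> linarith

/-- `T` is complementary to `S` if and only if `S S^* + T T^* = 1`. -/
theorem isComplementary_iff : S.IsComplementary T ↔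
    ∀ h, S.incl (S.incl.adjoint h) + T.incl (T.incl.adjoint h) = h := by
  have key : ∀ h, RCLike.re ⟪S.incl (S.incl.adjoint h) + T.incl (T.incl.adjoint h), h⟫_ℂ =
      ‖S.incl.adjoint h‖ ^ 2 + ‖T.incl.adjoint h‖ ^ 2 := by
    intro h
    rw [inner_add_left, ← ContinuousLinearMap.adjoint_inner_right S.incl,
      ← ContinuousLinearMap.adjoint_inner_right T.incl, map_add, inner_self_eq_norm_sq,
      inner_self_eq_norm_sq]
  constructor
  · intro hc h
    obtain ⟨p, ⟨hp, hn⟩, -⟩ := hc.existsUnique_decomposition h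
    -- With A = S S^* + T T^* and q = re ⟪A h, h⟫, contractivity of the sum gives ‖A h‖² ≤ q, while
    -- q ≤ ‖A h‖ ‖h‖ ≤ (‖A h‖² + ‖h‖²) / 2. Together q ≤ ‖h‖².
    have hle : ‖S.incl.adjoint h‖ ^ 2 + ‖T.incl.adjoint h‖ ^ 2 ≤ ‖h‖ ^ 2 := by
      have h1 := hc.norm_add_sq_le (S.incl.adjoint h) (T.incl.adjoint h)
      have h2 := re_inner_le_norm (𝕜 := ℂ) (S.incl (S.incl.adjoint h) + T.incl (T.incl.adjoint h)) h
      rw [key] at h2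
      nlinarith [sq_nonneg (‖S.incl (S.incl.adjoint h) + T.incl (T.incl.adjoint h)‖ - ‖h‖)]
    obtain ⟨hx, hy⟩ := eq_adjoint_of_norm_sq_eq hle hp hn
    rw [← hx, ← hy, hp]
  · intro hc
    have hnorm : ∀ h, ‖h‖ ^ 2 = ‖S.incl.adjoint h‖ ^ 2 + ‖T.incl.adjoint h‖ ^ 2 := fun h => by
      rw [← key, hc, inner_self_eq_norm_sq]
    refine ⟨fun x y => ?_, fun h => ⟨(S.incl.adjoint h, T.incl.adjoint h), ⟨hc h, hnorm h⟩, ?_⟩⟩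
    · set h := S.incl x + T.incl y with hh
      have h1 : ‖h‖ ^ 2 =
          RCLike.re ⟪x, S.incl.adjoint h⟫_ℂ + RCLike.re ⟪y, T.incl.adjoint h⟫_ℂ := by
        rw [ContinuousLinearMap.adjoint_inner_right, ContinuousLinearMap.adjoint_inner_right,
          ← map_add, ← inner_add_left, ← hh, inner_self_eq_norm_sq]
      have h2 := re_inner_le_norm (𝕜 := ℂ) x (S.incl.adjoint h)
      have h3 := re_inner_le_norm (𝕜 := ℂ) y (T.incl.adjoint h)
      have h4 := hnorm h
      nlinarith [sq_nonneg (‖x‖ - ‖S.incl.adjoint h‖), sq_nonneg (‖y‖ - ‖T.incl.adjoint h‖)]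
    · rintro ⟨x, y⟩ ⟨hp, hn⟩
      obtain ⟨hx, hy⟩ := eq_adjoint_of_norm_sq_eq (hnorm h).ge hp hn
      exact Prod.ext hx hy

end ContractiveSubspace

/-- The projection onto (ker T)ᗮ changes `T.adjoint h` only by a vector of ker T, which `T` does not
see. -/
theorem rangeSpace_incl_adjoint {C : Type v} [NormedAddCommGroup C] [InnerProductSpace ℂ C]
    [CompleteSpace C] (T : C →L[ℂ] H) (hT : ‖T‖ ≤ 1) (h : H) :
    (rangeSpace T hT).incl ((rangeSpace T hT).incl.adjoint h) = T (T.adjoint h) := by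
  let K := LinearMap.ker T.toLinearMap
  change (T ∘L Kᗮ.subtypeL) ((T ∘L Kᗮ.subtypeL).adjoint h) = _
  rw [ContinuousLinearMap.adjoint_comp, Submodule.adjoint_subtypeL]
  have h1 : T.adjoint h - Kᗮ.starProjection (T.adjoint h) ∈ Kᗮᗮ :=
    Submodule.sub_starProjection_mem_orthogonal _
  rw [Submodule.orthogonal_orthogonal] at h1
  have h2 : T (T.adjoint h - Kᗮ.starProjection (T.adjoint h)) = 0 := h1
  rw [map_sub, sub_eq_zero] at h2
  exact h2.symm

/-- The line spanned by `g`, with `g` as a unit vector. -/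
def lineSpace (g : H) (hg : g ≠ 0) (hg' : ‖g‖ ≤ 1) : ContractiveSubspace.{u, v} H where
  -- A one-dimensional space available in every universe, unlike ℂ itself.
  space := EuclideanSpace ℂ PUnit.{v + 1}
  incl := (EuclideanSpace.proj PUnit.unit : EuclideanSpace ℂ PUnit.{v + 1} →L[ℂ] ℂ).smulRight g
  incl_injective := by
    intro x y hxy
    ext i
    exact smul_left_injective ℂ hg hxy
  norm_incl_le x := by
    have : ‖x‖ = ‖x PUnit.unit‖ := by simp [EuclideanSpace.norm_eq]
    simpa [norm_smul, this] using mul_le_of_le_one_right (norm_nonneg _) hg'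

theorem lineSpace_incl_adjoint (g : H) (hg : g ≠ 0) (hg' : ‖g‖ ≤ 1) (h : H) :
    (lineSpace.{u, v} g hg hg').incl ((lineSpace.{u, v} g hg hg').incl.adjoint h) =
      ⟪g, h⟫_ℂ • g := by
  let p : EuclideanSpace ℂ PUnit.{v + 1} →L[ℂ] ℂ := EuclideanSpace.proj PUnit.unit
  change (p.smulRight g) ((p.smulRight g).adjoint h) = _
  have h1 : (p.smulRight g).adjoint h = EuclideanSpace.single PUnit.unit ⟪g, h⟫_ℂ := by
    refine ext_inner_left ℂ fun k => ?_
    rw [ContinuousLinearMap.adjoint_inner_right]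
    simp [p, EuclideanSpace.inner_single_right, mul_comm]
  rw [h1]
  simp [p]

/-- If `T T^*` is the rank one operator `h ↦ ⟪g, h⟫ g`, then the elements of `T` are orthogonal to
everything that `g` is orthogonal to. -/
theorem ContractiveSubspace.inner_incl_eq_zero {T : ContractiveSubspace.{u, w} H} {g : H}
    (hT : ∀ h, T.incl (T.incl.adjoint h) = ⟪g, h⟫_ℂ • g) {k : H} (hk : ⟪g, k⟫_ℂ = 0)
    (x : T.space) : ⟪T.incl x, k⟫_ℂ = 0 := by
  have : T.incl.adjoint k = 0 := T.incl_injective (by simp [hT, hk])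
  rw [← ContinuousLinearMap.adjoint_inner_right, this, inner_zero_right]

/-- Tensor version of `inner_incl_eq_zero`: the functional vanishes on elementary tensors, hence on
the whole completion. -/
theorem ContractiveSubspace.inner_htmul_eq_zero {E : Type*} [NormedAddCommGroup E]
    [InnerProductSpace ℂ E] {T : ContractiveSubspace.{u, w} H} {g : H}
    (hT : ∀ h, T.incl (T.incl.adjoint h) = ⟪g, h⟫_ℂ • g) {k : H} (hk : ⟪g, k⟫_ℂ = 0) (y : E)
    {t : HilbertTensor E H} (ht : t ∈ T.tensorCarrier E) : ⟪htmul y k, t⟫_ℂ = 0 := by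
  obtain ⟨s, rfl⟩ := ht
  have : innerSL ℂ (htmul y k) ∘L idTensor E T.incl = 0 := by
    refine clm_ext_htmul fun x n => ?_
    simp [idTensor_htmul, inner_htmul, inner_eq_zero_symm.1 (T.inner_incl_eq_zero hT hk n)]
  exact DFunLike.congr_fun this s

/-- If `T T^*` is the rank one operator `h ↦ ⟪g, h⟫ g`, then `T` contains `g`. -/
theorem ContractiveSubspace.mem_carrier {T : ContractiveSubspace.{u, w} H} {g : H} (hg : g ≠ 0)
    (hT : ∀ h, T.incl (T.incl.adjoint h) = ⟪g, h⟫_ℂ • g) : g ∈ T.carrier := by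
  have h1 : ⟪g, g⟫_ℂ ≠ 0 := inner_self_ne_zero.2 hg
  refine ⟨(⟪g, g⟫_ℂ)⁻¹ • T.incl.adjoint g, ?_⟩
  simp only [ContinuousLinearMap.coe_coe, map_smul, hT, smul_smul, inv_mul_cancel₀ h1, one_smul]

/-- If `T T^*` is the rank one operator `h ↦ ⟪g, h⟫ g`, then the elements of `E ⊗ T` are of the
form `x ⊗ g`, tested against elementary tensors. -/
theorem ContractiveSubspace.exists_inner_htmul_eq {E : Type*} [NormedAddCommGroup E]
    [InnerProductSpace ℂ E] [CompleteSpace E] {T : ContractiveSubspace.{u, w} H} {g : H}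
    (hg : g ≠ 0) (hT : ∀ h, T.incl (T.incl.adjoint h) = ⟪g, h⟫_ℂ • g)
    {t : HilbertTensor E H} (ht : t ∈ T.tensorCarrier E) :
    ∃ x : E, ∀ y k, ⟪htmul y k, t⟫_ℂ = ⟪y, x⟫_ℂ * ⟪k, g⟫_ℂ := by
  have h1 : ⟪g, g⟫_ℂ ≠ 0 := inner_self_ne_zero.2 hg
  -- The vector is the partial inner product of `t` with `g`, normalized by ‖g‖². Only the component
  -- of `k` along `g` contributes, by the orthogonality lemma.
  refine ⟨(⟪g, g⟫_ℂ)⁻¹ • (htmulRight E g).adjoint t, fun y k => ?_⟩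
  have h2 : ⟪g, k - (⟪g, k⟫_ℂ / ⟪g, g⟫_ℂ) • g⟫_ℂ = 0 := by
    rw [inner_sub_right, inner_smul_right, div_mul_cancel₀ _ h1, sub_self]
  have h3 := T.inner_htmul_eq_zero hT h2 y ht
  rw [htmul_sub_right, htmul_smul_right, inner_sub_left, inner_smul_left, sub_eq_zero, map_div₀,
    inner_conj_symm, inner_conj_symm] at h3
  rw [h3, inner_smul_right, ContinuousLinearMap.adjoint_inner_right, htmulRight_apply]
  ring

end Complementary

/-! ### Multipliers with rank one defect and their joint eigenvectors -/

section Kernels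

variable {Λ : Type w} (H : Type u) [NormedAddCommGroup H] [InnerProductSpace ℂ H]
  [CompleteSpace H] [RKHS ℂ H Λ ℂ]

variable {H} in
theorem ker_inner (l : Λ) (f : H) : ⟪ker H l, f⟫_ℂ = f l := by
  simp [ker]

theorem inner_ker_ker (m l : Λ) : ⟪ker H m, ker H l⟫_ℂ = kernel H m l := ker_inner m _

theorem span_ker_dense : (Submodule.span ℂ (Set.range (ker H))).topologicalClosure = ⊤ := by
  rw [eq_top_iff, ← RKHS.kerFun_dense (𝕜 := ℂ) H]
  refine Submodule.topologicalClosure_mono (Submodule.span_le.2 ?_)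
  rintro _ ⟨x, v, rfl⟩
  have hv : RKHS.kerFun H x v = v • ker H x := by
    rw [ker, ← map_smul, smul_eq_mul, mul_one]
  rw [hv]
  exact Submodule.smul_mem _ _ (Submodule.subset_span ⟨x, rfl⟩)

variable {E : Type v} [NormedAddCommGroup E] [InnerProductSpace ℂ E]

/-- If `(1 - ⟪γ m, γ l⟫) K m l = conj (c m) * c l`, then `k_l ↦ γ l ⊗ k_l` extends to a contraction
`T`, and `1 - T^* T` is the rank one operator given by the function `conj c`. -/
theorem exists_contraction_of_rank_one_defect {γ : Λ → E} {c : Λ → ℂ}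
    (h : ∀ m l, ⟪γ m, γ l⟫_ℂ * kernel H m l + conj (c m) * c l = kernel H m l) :
    ∃ (T : H →L[ℂ] HilbertTensor E H) (g : H), ‖T‖ ≤ 1 ∧ ‖g‖ ≤ 1 ∧
      (∀ l, T (ker H l) = htmul (γ l) (ker H l)) ∧ (∀ l, g l = conj (c l)) ∧
      ∀ f k, ⟪T f, T k⟫_ℂ + ⟪f, g⟫_ℂ * ⟪g, k⟫_ℂ = ⟪f, k⟫_ℂ := by
  -- Lurking isometry: the hypothesis says that k_l and (γ l ⊗ k_l, c l) have the same Gram matrix.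
  -- `T` is the first component of the isometry, and `g` represents the second.
  obtain ⟨V, hV⟩ := exists_isometry_of_inner_eq (span_ker_dense H)
    (e := fun l => (WithLp.toLp 2 (htmul (γ l) (ker H l), c l) : WithLp 2 (HilbertTensor E H × ℂ)))
    (fun m l => by
      rw [inner_ker_ker, ← h m l, WithLp.prod_inner_apply]
      simp [inner_htmul, inner_ker_ker, mul_comm])
  let T : H →L[ℂ] HilbertTensor E H := WithLp.fstL 2 ℂ _ _ ∘L V.toContinuousLinearMap
  let φ : H →L[ℂ] ℂ := WithLp.sndL 2 ℂ _ _ ∘L V.toContinuousLinearMap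
  let g : H := (InnerProductSpace.toDual ℂ H).symm φ
  have hg : ∀ k, ⟪g, k⟫_ℂ = φ k := fun k => InnerProductSpace.toDual_symm_apply
  have hTg : ∀ f k, ⟪T f, T k⟫_ℂ + ⟪f, g⟫_ℂ * ⟪g, k⟫_ℂ = ⟪f, k⟫_ℂ := by
    intro f k
    rw [← V.inner_map_map f k, WithLp.prod_inner_apply, ← inner_conj_symm f g, hg, hg]
    simp [T, φ, mul_comm]
  have hnorm : ∀ f, ‖T f‖ ^ 2 + ‖⟪g, f⟫_ℂ‖ ^ 2 = ‖f‖ ^ 2 := by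
    intro f
    have := congrArg RCLike.re (hTg f f)
    rw [map_add, inner_self_eq_norm_sq, inner_self_eq_norm_sq, ← inner_conj_symm f g,
      RCLike.conj_mul, ← RCLike.ofReal_pow, RCLike.ofReal_re] at this
    exact this
  refine ⟨T, g, ?_, ?_, fun l => ?_, fun l => ?_, hTg⟩
  · refine T.opNorm_le_bound zero_le_one fun f => ?_
    rw [one_mul]
    exact (sq_le_sq₀ (norm_nonneg _) (norm_nonneg _)).1 (by nlinarith [hnorm f, sq_nonneg ‖⟪g, f⟫_ℂ‖])
  · have h1 := hnorm g
    rw [inner_self_eq_norm_sq_to_K, ← RCLike.ofReal_pow, RCLike.norm_ofReal, abs_sq] at h1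
    by_contra! h2
    nlinarith [sq_nonneg ‖T g‖, mul_self_lt_mul_self zero_le_one h2, norm_nonneg g]
  · simp [T, hV]
  · rw [← ker_inner, ← inner_conj_symm, hg]
    simp [φ, hV]

/-- If `H` has the kernel `1 / (1 - ⟪b m, b l⟫)`, then the joint eigenvectors of the adjoint `T` of
the row multiplier `b` are multiples of `1 / (1 - ⟪b z, x⟫)`. -/
theorem apply_mul_eq_of_eigenvector {b : Λ → E} {T : H →L[ℂ] HilbertTensor E H} {e : H}
    (hT : ∀ l, T (ker H l) = htmul (b l) (ker H l)) (he : ∀ l, e l = 1)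
    (hTe : ∀ f k, ⟪T f, T k⟫_ℂ + ⟪f, e⟫_ℂ * ⟪e, k⟫_ℂ = ⟪f, k⟫_ℂ) {f : H} {x : E}
    (hf : ∀ y l, ⟪htmul y (ker H l), T f⟫_ℂ = ⟪y, x⟫_ℂ * f l) (l : Λ) :
    f l * (1 - ⟪b l, x⟫_ℂ) = ⟪e, f⟫_ℂ := by
  have h := hTe (ker H l) f
  rw [hT, hf, ker_inner, ker_inner, he] at h
  linear_combination -h

end Kernels

theorem eq_zero_of_inner_eq_zero {E : Type*} [NormedAddCommGroup E] [InnerProductSpace ℂ E]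
    [CompleteSpace E] {ι : Type*} {u : ι → E}
    (hu : (Submodule.span ℂ (Set.range u)).topologicalClosure = ⊤) {x : E}
    (h : ∀ i, ⟪u i, x⟫_ℂ = 0) : x = 0 := by
  have h1 : x ∈ (Submodule.span ℂ (Set.range u))ᗮ := by
    rw [Submodule.mem_orthogonal]
    intro y hy
    induction hy using Submodule.span_induction with
    | mem y hy => obtain ⟨i, rfl⟩ := hy; exact h i
    | zero => simp
    | add y z _ _ hy hz => rw [inner_add_left, hy, hz, add_zero]
    | smul c y _ hy => rw [inner_smul_left, hy, mul_zero]
  rwa [Submodule.topologicalClosure_eq_top_iff.1 hu, Submodule.mem_bot] at h1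

/-! ### The Halmos unitary and its transfer function -/

section Colligation

variable {B : Type v} [NormedAddCommGroup B] [InnerProductSpace ℂ B]

/-- The square root `1 - ⟪α, ·⟫ α / (1 + s)` of `1 - ⟪α, ·⟫ α`, where `s = √(1 - ‖α‖ ^ 2)`. -/
def defect (α : B) (s : ℝ) : B →L[ℂ] B :=
  ContinuousLinearMap.id ℂ B - ((1 + s : ℂ)⁻¹) • (innerSL ℂ α).smulRight α

theorem defect_apply (α : B) (s : ℝ) (y : B) :
    defect α s y = y - ((1 + s : ℂ)⁻¹ * ⟪α, y⟫_ℂ) • α := by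
  simp [defect, smul_smul]

variable {α : B} {s : ℝ}

theorem inner_self_eq_of_sq_add_sq (hα : s ^ 2 + ‖α‖ ^ 2 = 1) : ⟪α, α⟫_ℂ = 1 - (s : ℂ) ^ 2 := by
  rw [inner_self_eq_norm_sq_to_K]
  have : (‖α‖ : ℂ) ^ 2 = 1 - (s : ℂ) ^ 2 := by
    rw [eq_sub_iff_add_eq, add_comm]
    exact_mod_cast hα
  simpa using this

theorem one_add_ofReal_ne_zero (hs : 0 < s) : (1 + s : ℂ) ≠ 0 := by
  have : (1 + s : ℝ) ≠ 0 := by positivity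
  exact_mod_cast this

theorem inner_defect (hs : 0 < s) (hα : s ^ 2 + ‖α‖ ^ 2 = 1) (y : B) :
    ⟪α, defect α s y⟫_ℂ = s * ⟪α, y⟫_ℂ := by
  rw [defect_apply, inner_sub_right, inner_smul_right, inner_self_eq_of_sq_add_sq hα]
  field_simp [one_add_ofReal_ne_zero hs]
  ring

/-- The eigenvalue on α is 1 - ‖α‖² / (1 + s) = s, because ‖α‖² = (1 - s)(1 + s). Dividing by 1 + s
instead of ‖α‖² keeps α = 0 inside the general case. -/
theorem defect_self (hs : 0 < s) (hα : s ^ 2 + ‖α‖ ^ 2 = 1) : defect α s α = (s : ℂ) • α := by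
  have h : (1 + s : ℂ)⁻¹ * ⟪α, α⟫_ℂ = 1 - s := by
    rw [inner_self_eq_of_sq_add_sq hα]
    field_simp [one_add_ofReal_ne_zero hs]
    ring
  rw [defect_apply, h]
  module

theorem defect_defect (hs : 0 < s) (hα : s ^ 2 + ‖α‖ ^ 2 = 1) (y : B) :
    defect α s (defect α s y) = y - ⟪α, y⟫_ℂ • α := by
  rw [defect_apply, inner_defect hs hα, defect_apply, sub_sub, ← add_smul, ← mul_assoc, ← add_mul,
    ← mul_one_add, add_comm (1 : ℂ) s]
  rw [add_comm (s : ℂ) 1, inv_mul_cancel₀ (one_add_ofReal_ne_zero hs), one_mul]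

theorem inner_defect_left (x y : B) : ⟪defect α s x, y⟫_ℂ = ⟪x, defect α s y⟫_ℂ := by
  rw [defect_apply, defect_apply, inner_sub_left, inner_sub_right, inner_smul_left,
    inner_smul_right]
  simp
  ring

theorem inner_defect_defect (hs : 0 < s) (hα : s ^ 2 + ‖α‖ ^ 2 = 1) (x y : B) :
    ⟪defect α s x, defect α s y⟫_ℂ = ⟪x, y⟫_ℂ - ⟪x, α⟫_ℂ * ⟪α, y⟫_ℂ := by
  rw [inner_defect_left, defect_defect hs hα, inner_sub_right, inner_smul_right, mul_comm]

/-- The Halmos unitary `ℂ ⊕ B → B ⊕ ℂ` with first column `(α, s)`. -/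
def halmos (hs : 0 < s) (hα : s ^ 2 + ‖α‖ ^ 2 = 1) :
    DirectSum2 ℂ B ≃ₗᵢ[ℂ] DirectSum2 B ℂ :=
  LinearEquiv.isometryOfInner
    { toFun := fun p =>
        WithLp.toLp 2 (p.fst • α + defect α s p.snd, (s : ℂ) * p.fst - ⟪α, p.snd⟫_ℂ)
      invFun := fun q =>
        WithLp.toLp 2 (⟪α, q.fst⟫_ℂ + s * q.snd, defect α s q.fst - q.snd • α)
      map_add' := fun p q => by
        refine (WithLp.ofLp_injective 2) (Prod.ext ?_ ?_)
        · simp only [WithLp.add_fst, WithLp.add_snd, WithLp.ofLp_add, Prod.fst_add, map_add]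
          module
        · simp only [WithLp.add_fst, WithLp.add_snd, WithLp.ofLp_add, Prod.snd_add, inner_add_right]
          ring
      map_smul' := fun c p => by
        refine (WithLp.ofLp_injective 2) (Prod.ext ?_ ?_)
        · simp only [WithLp.smul_fst, WithLp.smul_snd, WithLp.ofLp_smul, Prod.smul_fst, map_smul,
            RingHom.id_apply, smul_eq_mul]
          module
        · simp only [WithLp.smul_fst, WithLp.smul_snd, WithLp.ofLp_smul, Prod.smul_snd,
            inner_smul_right, RingHom.id_apply, smul_eq_mul]
          ring
      left_inv := fun p => by
        refine (WithLp.ofLp_injective 2) (Prod.ext ?_ ?_)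
        · change ⟪α, p.fst • α + defect α s p.snd⟫_ℂ + s * (s * p.fst - ⟪α, p.snd⟫_ℂ) = p.fst
          rw [inner_add_right, inner_smul_right, inner_defect hs hα, inner_self_eq_of_sq_add_sq hα]
          ring
        · change defect α s (p.fst • α + defect α s p.snd) - (s * p.fst - ⟪α, p.snd⟫_ℂ) • α = p.snd
          rw [map_add, map_smul, defect_defect hs hα, defect_self hs hα]
          module
      right_inv := fun q => by
        refine (WithLp.ofLp_injective 2) (Prod.ext ?_ ?_)
        · change (⟪α, q.fst⟫_ℂ + s * q.snd) • α + defect α s (defect α s q.fst - q.snd • α) = q.fst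
          rw [map_sub, map_smul, defect_defect hs hα, defect_self hs hα]
          module
        · change s * (⟪α, q.fst⟫_ℂ + s * q.snd) - ⟪α, defect α s q.fst - q.snd • α⟫_ℂ = q.snd
          rw [inner_sub_right, inner_smul_right, inner_defect hs hα, inner_self_eq_of_sq_add_sq hα]
          ring }
    (fun p q => by
      have h1 : ∀ y : B, ⟪defect α s y, α⟫_ℂ = s * ⟪y, α⟫_ℂ := fun y => by
        rw [inner_defect_left, defect_self hs hα, inner_smul_right]
      simp only [LinearEquiv.coe_mk, LinearMap.coe_mk, AddHom.coe_mk, WithLp.prod_inner_apply,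
        inner_add_left, inner_add_right, inner_smul_left, inner_smul_right, inner_defect hs hα,
        inner_self_eq_of_sq_add_sq hα, h1, inner_defect_defect hs hα, RCLike.inner_apply, map_sub,
        map_mul, inner_conj_symm, Complex.conj_ofReal]
      change _ = q.fst * conj p.fst + ⟪p.snd, q.snd⟫_ℂ
      ring)

theorem blockA_halmos (hs : 0 < s) (hα : s ^ 2 + ‖α‖ ^ 2 = 1) (t : ℂ) :
    blockA (halmos hs hα) t = t • α := by
  simp [blockA, halmos, inclLeft]

theorem blockB_halmos (hs : 0 < s) (hα : s ^ 2 + ‖α‖ ^ 2 = 1) (y : B) :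
    blockB (halmos hs hα) y = defect α s y := by
  simp [blockB, halmos, inclRight]

theorem blockC_halmos (hs : 0 < s) (hα : s ^ 2 + ‖α‖ ^ 2 = 1) (t : ℂ) :
    blockC (halmos hs hα) t = s * t := by
  simp [blockC, halmos, inclLeft]

theorem blockD_halmos (hs : 0 < s) (hα : s ^ 2 + ‖α‖ ^ 2 = 1) (y : B) :
    blockD (halmos hs hα) y = -⟪α, y⟫_ℂ := by
  simp [blockD, halmos, inclRight]

theorem one_sub_comp_blockA_halmos (hs : 0 < s) (hα : s ^ 2 + ‖α‖ ^ 2 = 1) (ξ : B) :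
    1 - innerSL ℂ ξ ∘L blockA (halmos hs hα) = (1 - ⟪ξ, α⟫_ℂ) • (1 : ℂ →L[ℂ] ℂ) := by
  ext
  simp [blockA_halmos]

theorem isUnit_smul_one {c : ℂ} (hc : c ≠ 0) : IsUnit (c • (1 : ℂ →L[ℂ] ℂ)) :=
  (isUnit_one).smul (Units.mk0 c hc)

/-- The resolvent acts on ℂ, so it is a scalar, and the transfer function is the inner product
against one explicit vector. -/
theorem transferFunction_halmos [CompleteSpace B] (hs : 0 < s) (hα : s ^ 2 + ‖α‖ ^ 2 = 1) {ξ : B}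
    (hξ : 1 - ⟪ξ, α⟫_ℂ ≠ 0) :
    (transferFunction (halmos hs hα) (innerSL ℂ ξ)).adjoint 1 =
      conj (s / (1 - ⟪ξ, α⟫_ℂ)) • defect α s ξ - α := by
  have hinv : Ring.inverse ((1 - ⟪ξ, α⟫_ℂ) • (1 : ℂ →L[ℂ] ℂ)) = (1 - ⟪ξ, α⟫_ℂ)⁻¹ • 1 := by
    refine ((isUnit_smul_one hξ).mul_right_injective) ?_
    change (1 - ⟪ξ, α⟫_ℂ) • (1 : ℂ →L[ℂ] ℂ) * _ = (1 - ⟪ξ, α⟫_ℂ) • (1 : ℂ →L[ℂ] ℂ) * _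
    rw [Ring.mul_inverse_cancel _ (isUnit_smul_one hξ), smul_mul_smul_comm, mul_inv_cancel₀ hξ,
      one_smul, one_mul]
  have h : transferFunction (halmos hs hα) (innerSL ℂ ξ) =
      innerSL ℂ (conj (s / (1 - ⟪ξ, α⟫_ℂ)) • defect α s ξ - α) := by
    ext y
    rw [transferFunction, one_sub_comp_blockA_halmos, hinv]
    simp only [add_apply, ContinuousLinearMap.comp_apply, blockD_halmos,
      blockC_halmos, blockB_halmos, innerSL_apply_apply, smul_apply,
      one_apply_eq_self, smul_eq_mul, inner_sub_left, inner_smul_left,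
      RCLike.conj_conj, inner_defect_left]
    ring
  rw [h, ContinuousLinearMap.adjoint_innerSL_apply]
  simp

/-- The defect kernel of the transfer function of the Halmos unitary. -/
theorem inner_transferFunction_halmos [CompleteSpace B] (hs : 0 < s)
    (hα : s ^ 2 + ‖α‖ ^ 2 = 1) {ξ η : B} (hξ : 1 - ⟪ξ, α⟫_ℂ ≠ 0) (hη : 1 - ⟪η, α⟫_ℂ ≠ 0) :
    ⟪(transferFunction (halmos hs hα) (innerSL ℂ ξ)).adjoint 1,
      (transferFunction (halmos hs hα) (innerSL ℂ η)).adjoint 1⟫_ℂ =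
      1 - s / (1 - ⟪ξ, α⟫_ℂ) * conj (s / (1 - ⟪η, α⟫_ℂ)) * (1 - ⟪ξ, η⟫_ℂ) := by
  have h1 : ∀ y : B, ⟪defect α s y, α⟫_ℂ = s * ⟪y, α⟫_ℂ := fun y => by
    rw [inner_defect_left, defect_self hs hα, inner_smul_right]
  have hη' : 1 - ⟪α, η⟫_ℂ ≠ 0 := fun h => hη (by
    rw [← inner_conj_symm η α, ← map_one (starRingEnd ℂ), ← map_sub, h, map_zero])
  -- Explicit form of the unitary colligation identity: 1 - G G^* equals c (1 - Z a)⁻¹ (1 - Z Z^*)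
  -- times the adjoint factor, with c = s.
  rw [transferFunction_halmos hs hα hξ, transferFunction_halmos hs hα hη]
  simp only [inner_sub_left, inner_sub_right, inner_smul_left, inner_smul_right, h1,
    inner_defect hs hα, inner_defect_defect hs hα, inner_self_eq_of_sq_add_sq hα, map_div₀,
    map_sub, map_one, inner_conj_symm, Complex.conj_ofReal]
  field_simp
  ring

end Colligation

/-! ### Consequences of the normalization at the base point -/

section Normalized

variable {Λ : Type w} {H : Type u} [NormedAddCommGroup H] [InnerProductSpace ℂ H]
  [CompleteSpace H] [RKHS ℂ H Λ ℂ]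
  {B : Type v} [NormedAddCommGroup B] [InnerProductSpace ℂ B]
  {l₀ : Λ} {β : Λ → B}

/-- Normalization makes the kernel function at `l₀` the constant ‖k‖; its value at `l₀` is also
‖k‖², and ‖k‖ ≠ 0, so the constant is 1. -/
theorem ker_apply_of_isNormalizedAt (hnorm : IsNormalizedAt H l₀) (m : Λ) : ker H l₀ m = 1 := by
  have h : ∀ m, (‖ker H l₀‖ : ℂ)⁻¹ * ker H l₀ m = 1 := fun m => by
    simpa [normalizedKer] using hnorm m
  have h0 : (‖ker H l₀‖ : ℂ) ≠ 0 := fun h' => by simpa [h'] using h l₀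
  have h1 : ∀ m, ker H l₀ m = ‖ker H l₀‖ := fun m => by
    have := h m
    rwa [inv_mul_eq_div, div_eq_one_iff_eq h0] at this
  have h2 := h1 l₀
  rw [← ker_inner, inner_self_eq_norm_sq_to_K, sq] at h2
  rw [h1 m]
  exact mul_right_cancel₀ h0 (h2.trans (one_mul _).symm)

theorem kernel_eq_of_isNormalizedAt (hnorm : IsNormalizedAt H l₀) (hβ : IsPickRealization H l₀ β)
    (m l : Λ) : kernel H m l = (1 - ⟪β m, β l⟫_ℂ)⁻¹ := by
  simp [hβ.kernel_eq, hnorm m, hnorm l]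

theorem kernel_ne_zero_of_isNormalizedAt (hnorm : IsNormalizedAt H l₀) (l : Λ) :
    kernel H l l ≠ 0 := by
  rw [← inner_ker_ker, inner_self_ne_zero]
  intro h
  have := ker_apply_of_isNormalizedAt hnorm l
  rw [← ker_inner, h, inner_zero_left] at this
  exact zero_ne_one this

theorem apply_base_eq_zero [CompleteSpace B] (hnorm : IsNormalizedAt H l₀)
    (hβ : IsPickRealization H l₀ β) : β l₀ = 0 := by
  refine eq_zero_of_inner_eq_zero hβ.minimal fun m => ?_
  have h := kernel_eq_of_isNormalizedAt hnorm hβ m l₀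
  rw [kernel, ker_apply_of_isNormalizedAt hnorm, eq_comm, inv_eq_one] at h
  linear_combination -h

/-- (1 - ‖β l‖²)⁻¹ = ‖k_l‖² is positive. This puts `J (β l)` in the open ball. -/
theorem norm_lt_one_of_isNormalizedAt (hnorm : IsNormalizedAt H l₀)
    (hβ : IsPickRealization H l₀ β) (l : Λ) : ‖β l‖ < 1 := by
  have h := kernel_eq_of_isNormalizedAt hnorm hβ l l
  have h0 := kernel_ne_zero_of_isNormalizedAt hnorm l
  rw [← inner_ker_ker, inner_self_eq_norm_sq_to_K] at h h0
  rw [inner_self_eq_norm_sq_to_K] at h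
  have h1 : ‖ker H l‖ ^ 2 = (1 - ‖β l‖ ^ 2)⁻¹ := by
    apply Complex.ofReal_injective
    push_cast
    exact h
  have h2 : 0 < ‖ker H l‖ ^ 2 := by
    refine lt_of_le_of_ne (sq_nonneg _) fun h' => h0 ?_
    rw [← RCLike.ofReal_pow, ← h', RCLike.ofReal_zero]
  rw [h1, inv_pos] at h2
  nlinarith [norm_nonneg (β l)]

end Normalized

theorem one_sub_inner_ne_zero {E : Type*} [NormedAddCommGroup E] [InnerProductSpace ℂ E] {x y : E}
    (hx : ‖x‖ < 1) (hy : ‖y‖ < 1) : 1 - ⟪x, y⟫_ℂ ≠ 0 := by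
  intro h
  have h1 : ‖⟪x, y⟫_ℂ‖ < 1 := (norm_inner_le_norm x y).trans_lt (by
    nlinarith [norm_nonneg x, norm_nonneg y])
  rw [← sub_eq_zero.1 h, norm_one] at h1
  exact lt_irrefl _ h1

/-- Polarization gives the real parts; replacing `y` by i y gives the imaginary parts, whose sign
flips by antilinearity. -/
theorem inner_conj_conj {E : Type*} [NormedAddCommGroup E] [InnerProductSpace ℂ E]
    (J : E ≃ₗᵢ⋆[ℂ] E) (x y : E) : ⟪J x, J y⟫_ℂ = ⟪y, x⟫_ℂ := by
  have hre : ∀ x y : E, RCLike.re ⟪J x, J y⟫_ℂ = RCLike.re ⟪x, y⟫_ℂ := fun x y => by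
    rw [re_inner_eq_norm_add_mul_self_sub_norm_mul_self_sub_norm_mul_self_div_two,
      re_inner_eq_norm_add_mul_self_sub_norm_mul_self_sub_norm_mul_self_div_two, ← map_add,
      J.norm_map, J.norm_map, J.norm_map]
  have him := hre x (Complex.I • y)
  rw [map_smulₛₗ, inner_smul_right, inner_smul_right] at him
  rw [← inner_conj_symm y x, Complex.ext_iff, Complex.conj_re, Complex.conj_im]
  exact ⟨hre x y, by simpa using him⟩

/-! ### The complementary line and the transfer to the Drury-Arveson space -/

section Main

variable {Λ : Type w} {H : Type u} [NormedAddCommGroup H] [InnerProductSpace ℂ H]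
  [CompleteSpace H] [RKHS ℂ H Λ ℂ]
  {B : Type v} [NormedAddCommGroup B] [InnerProductSpace ℂ B] [CompleteSpace B]

theorem multiplierRange_incl_adjoint {G' : Type v} [NormedAddCommGroup G']
    [InnerProductSpace ℂ G'] [CompleteSpace G'] {G : Λ → G' →L[ℂ] ℂ}
    (hG : IsContractiveMultiplier H G) {g : H}
    (hg : ∀ f k, ⟪multiplierAdjoint hG f, multiplierAdjoint hG k⟫_ℂ + ⟪f, g⟫_ℂ * ⟪g, k⟫_ℂ =
      ⟪f, k⟫_ℂ) (h : H) :
    (multiplierRange hG).incl ((multiplierRange hG).incl.adjoint h) = h - ⟪g, h⟫_ℂ • g := by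
  have hn : ‖multiplier hG‖ ≤ 1 := by
    change ‖(multiplierAdjoint hG).adjoint‖ ≤ 1
    rw [LinearIsometryEquiv.norm_map]
    exact norm_multiplierAdjoint_le hG
  have h1 := rangeSpace_incl_adjoint (multiplier hG) hn h
  have h2 : (multiplier hG).adjoint = multiplierAdjoint hG :=
    ContinuousLinearMap.adjoint_adjoint _
  rw [h2] at h1
  refine h1.trans (ext_inner_left ℂ fun f => ?_)
  change ⟪f, (multiplierAdjoint hG).adjoint (multiplierAdjoint hG h)⟫_ℂ = _
  rw [ContinuousLinearMap.adjoint_inner_right, inner_sub_right, inner_smul_right, ← hg f h]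
  ring

/-- If `1 - T^* T` is the rank one operator `f ↦ ⟪g, f⟫ g`, for `T = m_G^*`, then a contractive
subspace is complementary to `M_G` if and only if it is the line spanned by the unit vector `g`. -/
theorem isComplementary_multiplierRange_iff {G' : Type v} [NormedAddCommGroup G']
    [InnerProductSpace ℂ G'] [CompleteSpace G'] {G : Λ → G' →L[ℂ] ℂ}
    (hG : IsContractiveMultiplier H G) {g : H}
    (hg : ∀ f k, ⟪multiplierAdjoint hG f, multiplierAdjoint hG k⟫_ℂ + ⟪f, g⟫_ℂ * ⟪g, k⟫_ℂ =
      ⟪f, k⟫_ℂ) (N : ContractiveSubspace H) :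
    (multiplierRange hG).IsComplementary N ↔ ∀ h, N.incl (N.incl.adjoint h) = ⟪g, h⟫_ℂ • g := by
  rw [ContractiveSubspace.isComplementary_iff]
  refine forall_congr' fun h => ?_
  rw [multiplierRange_incl_adjoint hG hg, sub_add_eq_add_sub, sub_eq_iff_eq_add, add_right_inj]

/-- If the adjoint `T` of the row multiplier `β` on `H` has a joint eigenvector
`g = s / (1 - ⟪β, J α⟫)`, then functions in the Drury-Arveson space that vanish on the range of
`J β` vanish at `α`. -/
theorem apply_eq_zero_of_eigenvector {β : Λ → B} {J : B ≃ₗᵢ⋆[ℂ] B} (hJ : ∀ x, J (J x) = x)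
    (hK : ∀ m l, kernel H m l = (1 - ⟪β m, β l⟫_ℂ)⁻¹) (hβ : ∀ l, ‖β l‖ < 1)
    (hmin : (Submodule.span ℂ (Set.range β)).topologicalClosure = ⊤) {l₀ : Λ} (hl₀ : β l₀ = 0)
    {T : H →L[ℂ] HilbertTensor B H} (hT : ∀ l, T (ker H l) = htmul (β l) (ker H l))
    {α : Metric.ball (0 : B) 1} {s : ℂ} (hs : s ≠ 0) {g : H}
    (hg : ∀ l, g l = s / (1 - ⟪β l, J α⟫_ℂ)) {x : B}
    (hx : ∀ y k, ⟪htmul y k, T g⟫_ℂ = ⟪y, x⟫_ℂ * ⟪k, g⟫_ℂ)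
    {f : DruryArveson B} (hf : ∀ z : Metric.ball (0 : B) 1, (∃ l, (z : B) = J (β l)) → f z = 0) :
    f α = 0 := by
  have hball : ∀ z : Metric.ball (0 : B) 1, ‖J z‖ < 1 := fun z => by
    rw [J.norm_map]; exact mem_ball_zero_iff.1 z.2
  have hKD : ∀ z w, kernel (DruryArveson B) z w = (1 - ⟪J z, J w⟫_ℂ)⁻¹ := fun z w => by
    rw [kernel_druryArveson, druryArvesonKernel, inner_conj_conj, one_div]
  -- `S` is the Drury-Arveson analogue of `T`; its defect is the rank one operator given by the
  -- constant function `e` = 1. The conjugation turns the kernel into (1 - ⟪J z, J w⟫)⁻¹, the form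
  -- of the kernel of `H`.
  obtain ⟨S, e, -, -, hS, he, hSe⟩ := exists_contraction_of_rank_one_defect (DruryArveson B)
    (γ := fun z : Metric.ball (0 : B) 1 => J z) (c := fun _ => 1) (fun z w => by
      rw [hKD]
      have := one_sub_inner_ne_zero (hball z) (hball w)
      field_simp
      simp)
  let ζ : Λ → Metric.ball (0 : B) 1 := fun l =>
    ⟨J (β l), by rw [mem_ball_zero_iff, J.norm_map]; exact hβ l⟩
  have hζ : ∀ l, J (ζ l) = β l := fun l => hJ (β l)
  obtain ⟨V, hV⟩ := exists_isometry_of_inner_eq (span_ker_dense H)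
    (e := fun l => ker (DruryArveson B) (ζ l)) (fun m l => by
      rw [inner_ker_ker, inner_ker_ker, hKD, hK, hζ, hζ])
  let W : H →L[ℂ] DruryArveson B := V.toContinuousLinearMap
  have hW : ∀ l, W (ker H l) = ker (DruryArveson B) (ζ l) := hV
  -- The intertwining carries the eigenvector relation from g to W g.
  have hSW : S ∘L W = idTensor B W ∘L T := by
    refine ContinuousLinearMap.ext_on
      (Submodule.dense_iff_topologicalClosure_eq_top.2 (span_ker_dense H)) ?_
    rintro _ ⟨l, rfl⟩
    simp only [ContinuousLinearMap.comp_apply, hW, hS, hT, idTensor_htmul, hζ]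
  have hSWg : S (W g) = idTensor B W (T g) := DFunLike.congr_fun hSW g
  have hWg := apply_mul_eq_of_eigenvector (DruryArveson B) (b := fun z : Metric.ball (0 : B) 1 => J z) hS
    (fun z => by rw [he, map_one]) hSe (f := W g) (x := x) (fun y z => by
      rw [hSWg, inner_htmul_idTensor, hx, ContinuousLinearMap.adjoint_inner_left, ker_inner])
  have hWgζ : ∀ l, W g (ζ l) = g l := fun l => by
    rw [← ker_inner, ← hW, ← ker_inner]
    exact V.inner_map_map _ _
  -- Evaluation at the base point, where β vanishes.
  have hes : ⟪e, W g⟫_ℂ = s := by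
    rw [← hWg (ζ l₀), hWgζ, hg, hζ, hl₀]
    simp
  -- Both formulas for W g at `ζ l` have numerator s, so ⟪β l, x⟫ = ⟪β l, J α⟫ for all l; density of
  -- the span of β forces x = J α.
  have hxα : x = J α := by
    refine sub_eq_zero.1 (eq_zero_of_inner_eq_zero hmin fun l => ?_)
    have h1 := hWg (ζ l)
    have h2 := one_sub_inner_ne_zero (hβ l) (hball α)
    rw [hes, hWgζ, hg, hζ, div_mul_eq_mul_div, div_eq_iff h2, mul_right_inj' hs] at h1
    rw [inner_sub_right]
    linear_combination -h1
  have hWg' : W g = s • ker (DruryArveson B) α := by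
    ext z
    have h2 := one_sub_inner_ne_zero (hball z) (hball α)
    have h1 := hWg z
    rw [hes, hxα, ← eq_div_iff h2] at h1
    rw [h1, RKHS.coe_smul, Pi.smul_apply, smul_eq_mul, div_eq_mul_inv, ← hKD]
    rfl
  -- Vanishing on the points `ζ l` is orthogonality to the range of `W`.
  have hWf : W.adjoint f = 0 := by
    refine eq_zero_of_inner_eq_zero (span_ker_dense H) fun l => ?_
    rw [ContinuousLinearMap.adjoint_inner_right, hW, ker_inner, hf _ ⟨l, rfl⟩]
  have h3 : ⟪W g, f⟫_ℂ = 0 := by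
    rw [← ContinuousLinearMap.adjoint_inner_right, hWf, inner_zero_right]
  rw [hWg', inner_smul_left, ker_inner] at h3
  exact (mul_eq_zero.1 h3).resolve_left (by simpa using hs)

end Main

end PickSpace

end

/-! ### Assembly of the counterexample -/

open PickSpace
theorem mainTheorem4 {Λ : Type*} {H : Type*} [NormedAddCommGroup H] [InnerProductSpace ℂ H]
    [CompleteSpace H] [RKHS ℂ H Λ ℂ]
    {B : Type*} [NormedAddCommGroup B] [InnerProductSpace ℂ B] [CompleteSpace B]
    (hK : PickSpace.IsPickKernel (PickSpace.kernel H))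
    (l₀ : Λ) (hnorm : PickSpace.IsNormalizedAt H l₀)
    (β : Λ → B) (hβ : PickSpace.IsPickRealization H l₀ β)
    (J : B ≃ₗᵢ⋆[ℂ] B) (hJ : ∀ x, J (J x) = x)
    (hE : ¬ PickSpace.IsUniquenessSet
      {z : Metric.ball (0 : B) 1 | ∃ l : Λ, (z : B) = J (β l)}) :
    ∃ hB : PickSpace.IsContractiveMultiplier H (PickSpace.row β),
    ∃ U : PickSpace.DirectSum2 ℂ B ≃ₗᵢ[ℂ] PickSpace.DirectSum2 B ℂ,
      (∀ l, IsUnit (1 - PickSpace.row β l ∘L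
        PickSpace.blockA U)) ∧
      (∀ x y : B, Commute
        (PickSpace.coordinate
          (PickSpace.blockA U) x)
        (PickSpace.coordinate
          (PickSpace.blockA U) y)) ∧
      ∃ hG : PickSpace.IsContractiveMultiplier H (fun l => PickSpace.transferFunction
          U (PickSpace.row β l)),
        (∃ N : PickSpace.ContractiveSubspace H,
          (PickSpace.multiplierRange hG).IsComplementary N) ∧
        ∀ N : PickSpace.ContractiveSubspace H,
          (PickSpace.multiplierRange hG).IsComplementary N →
            ¬ N.carrier.map (PickSpace.multiplierAdjoint hB).toLinearMap ≤ N.tensorCarrier B := by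
  have hb := norm_lt_one_of_isNormalizedAt hnorm hβ
  have hKe := kernel_eq_of_isNormalizedAt hnorm hβ
  have hb0 := apply_base_eq_zero hnorm hβ
  obtain ⟨f, hf, α', hα'⟩ : ∃ f : DruryArveson B,
      (∀ z : Metric.ball (0 : B) 1, (∃ l, (z : B) = J (β l)) → f z = 0) ∧ ∃ α, f α ≠ 0 := by
    unfold IsUniquenessSet at hE
    push Not at hE
    obtain ⟨f, hf, hf0⟩ := hE
    refine ⟨f, fun z hz => hf z hz, ?_⟩
    by_contra! h
    exact hf0 (RKHS.ext fun z => by simpa using h z)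
  obtain ⟨TB, -, hTB, -, hTB', -⟩ := exists_contraction_of_rank_one_defect H
    (γ := β) (c := fun _ => 1) (fun m l => by
      rw [hKe]
      have := one_sub_inner_ne_zero (hb m) (hb l)
      field_simp
      simp)
  have hrow : IsMultiplierAdjoint H (row β) TB := fun l => by
    rw [hTB', row, ContinuousLinearMap.adjoint_innerSL_apply]
    simp
  set α : B := J α' with hα
  have hα1 : ‖α‖ < 1 := by
    rw [hα, J.norm_map]
    exact mem_ball_zero_iff.1 α'.2
  obtain ⟨s, hs, hsα⟩ : ∃ s : ℝ, 0 < s ∧ s ^ 2 + ‖α‖ ^ 2 = 1 := by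
    have h : 0 < 1 - ‖α‖ ^ 2 := by nlinarith [norm_nonneg α]
    exact ⟨√(1 - ‖α‖ ^ 2), Real.sqrt_pos.2 h, by rw [Real.sq_sqrt h.le]; ring⟩
  have hτ : ∀ l, 1 - ⟪β l, α⟫_ℂ ≠ 0 := fun l => one_sub_inner_ne_zero (hb l) hα1
  -- The factor 1 - ⟪β m, β l⟫ in the defect of the transfer function cancels the kernel of `H`,
  -- leaving a product of rank one.
  obtain ⟨TG, g, hTG, hg1, hTG', hg, hTGg⟩ := exists_contraction_of_rank_one_defect H
    (γ := fun l => (transferFunction (halmos hs hsα) (row β l)).adjoint 1)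
    (c := fun l => conj (s / (1 - ⟪β l, α⟫_ℂ))) (fun m l => by
      rw [row, row, inner_transferFunction_halmos hs hsα (hτ m) (hτ l), hKe, RCLike.conj_conj]
      have := one_sub_inner_ne_zero (hb m) (hb l)
      field_simp
      ring)
  have hG : IsContractiveMultiplier H fun l => transferFunction (halmos hs hsα) (row β l) :=
    ⟨TG, hTG, hTG'⟩
  have hgs : ∀ l, g l = s / (1 - ⟪β l, α⟫_ℂ) := fun l => by rw [hg, RCLike.conj_conj]
  have hg0 : g ≠ 0 := fun h => by
    have := hgs l₀
    rw [h, hb0] at this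
    exact hs.ne (Complex.ofReal_injective (by simpa using this))
  rw [multiplierAdjoint_unique hG TG hTG'] at hTGg
  have hB : IsContractiveMultiplier H (row β) := ⟨TB, hTB, hrow⟩
  refine ⟨hB, halmos hs hsα, fun l => ?_, fun x y => ?_, hG, ?_, fun N hN hle => ?_⟩
  · rw [row, one_sub_comp_blockA_halmos]
    exact isUnit_smul_one (hτ l)
  · ext
    simp [coordinate, blockA_halmos, mul_comm]
  -- Existence of a complement keeps the final universal clause from being vacuous.
  · exact ⟨lineSpace g hg0 hg1, (isComplementary_multiplierRange_iff hG hTGg _).2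
      (lineSpace_incl_adjoint g hg0 hg1)⟩
  · rw [isComplementary_multiplierRange_iff hG hTGg] at hN
    rw [← multiplierAdjoint_unique hB TB hrow] at hle
    -- The assumed inclusion is applied to g itself, which lies in `N`; x is the joint eigenvalue.
    obtain ⟨x, hx⟩ := N.exists_inner_htmul_eq hg0 hN
      (hle (Submodule.mem_map_of_mem (N.mem_carrier hg0 hN)))
    exact hα' (apply_eq_zero_of_eigenvector hJ hKe hb hβ.minimal hb0 hTB'
      (Complex.ofReal_ne_zero.2 hs.ne') hgs hx hf)
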